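/- Let $d\ge 0$ be an integer, let $(\mu_k)_{k\in\mathbb Z}$ be Borel probability measures on $\mathbb R^d$, and let $\phi:\mathbb R^d\to\mathbb R^d$ be an invertible linear map. For a Borel probability measure $\rho$ on $\mathbb R^d$ and an integer $k$, let $\phi^k(\rho)$ denote the image of $\rho$ under $\phi^k$, and let $*$ denote convolution. A solution is a family $(\lambda_k)_{k\in\mathbb Z}$ of Borel probability measures on $\mathbb R^d$ such that $$\lambda_k=\mu_k*\phi(\lambda_{k-1})\qquad\text{for all }k\in\mathbb Z. \tag{1}$$ A solution $(\lambda_k)$ is called fundamental if for every solution $(\nu_k)$ of (1) there is a Borel probability measure $\nu$ on $\mathbb R^d$ such that $\nu_k=\lambda_k*\phi^k(\nu)$ for all $k\in\mathbb Z$. Let $(\lambda_k)$ be a solution of (1). Then $(\lambda_k)$ is fundamental if and only if for every solution $(\nu_k)$ of (1) there is a Borel probability measure $\nu$ on $\mathbb R^d$ such that $\nu_0=\lambda_0*\nu$. -/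

import Mathlib

open MeasureTheory

/-- `lam` solves the convolution equation `lam k = mu k ∗ φ (lam (k - 1))` for all integers `k`. -/
def IsSolution {d : ℕ} (mu : ℤ → ProbabilityMeasure (EuclideanSpace ℝ (Fin d)))
    (φ : EuclideanSpace ℝ (Fin d) ≃ₗ[ℝ] EuclideanSpace ℝ (Fin d))
    (lam : ℤ → ProbabilityMeasure (EuclideanSpace ℝ (Fin d))) : Prop :=
  ∀ k : ℤ, (lam k : Measure (EuclideanSpace ℝ (Fin d))) =
    Measure.conv (mu k : Measure (EuclideanSpace ℝ (Fin d)))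
      (Measure.map φ (lam (k - 1) : Measure (EuclideanSpace ℝ (Fin d))))

/-- A solution `lam` is fundamental if every solution is of the form `lam k ∗ φ ^ k (ρ)`, `k : ℤ`,
for one probability measure `ρ`. Here `φ ^ k` is the integer power for composition. -/
def IsFundamentalSolution {d : ℕ} (mu : ℤ → ProbabilityMeasure (EuclideanSpace ℝ (Fin d)))
    (φ : EuclideanSpace ℝ (Fin d) ≃ₗ[ℝ] EuclideanSpace ℝ (Fin d))
    (lam : ℤ → ProbabilityMeasure (EuclideanSpace ℝ (Fin d))) : Prop :=
  IsSolution mu φ lam ∧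
    ∀ nu : ℤ → ProbabilityMeasure (EuclideanSpace ℝ (Fin d)), IsSolution mu φ nu →
      ∃ ρ : ProbabilityMeasure (EuclideanSpace ℝ (Fin d)), ∀ k : ℤ,
        (nu k : Measure (EuclideanSpace ℝ (Fin d))) =
          Measure.conv (lam k : Measure (EuclideanSpace ℝ (Fin d)))
            (Measure.map (φ ^ k) (ρ : Measure (EuclideanSpace ℝ (Fin d))))

/-! Applying `φ ^ (-k)` at time `k` reduces the equation to `ν k = μ k ∗ ν (k - 1)`.
`exists_fundamental` gives this a fundamental solution `κ`, a limit of shifted partial convolutions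
of the `μ k`; tightness comes from the given solution. Then `lam k = κ k ∗ ρ` for all `k`, and the
hypothesis at time 0 gives `κ 0 = lam 0 ∗ σ`. So `κ 0 = κ 0 ∗ (ρ ∗ σ)`, and
`eq_diracProb_zero_of_convProb_eq` forces `ρ ∗ σ = δ₀`. Hence `κ k = lam k ∗ σ` at every time, and
`lam` inherits fundamentality from `κ`. -/

open Filter Topology

set_option linter.unusedSectionVars false

section Convolution

variable {E : Type*} [NormedAddCommGroup E] [InnerProductSpace ℝ E] [FiniteDimensional ℝ E]
  [MeasurableSpace E] [BorelSpace E]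

/-- Convolution of probability measures. -/
noncomputable def convProb (μ ν : ProbabilityMeasure E) : ProbabilityMeasure E :=
  ⟨Measure.conv (μ : Measure E) (ν : Measure E), inferInstance⟩

/-- The Dirac measure at `x` as a probability measure. -/
noncomputable def diracProb (x : E) : ProbabilityMeasure E := ⟨Measure.dirac x, inferInstance⟩

lemma coe_convProb (μ ν : ProbabilityMeasure E) :
    (convProb μ ν : Measure E) = Measure.conv (μ : Measure E) (ν : Measure E) := rfl

lemma coe_diracProb (x : E) : (diracProb x : Measure E) = Measure.dirac x := rfl

lemma charFun_convProb (μ ν : ProbabilityMeasure E) (t : E) :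
    charFun (convProb μ ν : Measure E) t = charFun (μ : Measure E) t * charFun (ν : Measure E) t :=
  charFun_conv t

lemma convProb_comm (μ ν : ProbabilityMeasure E) : convProb μ ν = convProb ν μ :=
  Subtype.ext (Measure.conv_comm _ _)

lemma convProb_assoc (μ ν ρ : ProbabilityMeasure E) :
    convProb (convProb μ ν) ρ = convProb μ (convProb ν ρ) :=
  Subtype.ext (Measure.conv_assoc _ _ _)

lemma diracProb_zero_convProb (μ : ProbabilityMeasure E) : convProb (diracProb 0) μ = μ :=
  Subtype.ext (Measure.dirac_zero_conv _)

lemma diracProb_convProb_diracProb_neg (a : E) :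
    convProb (diracProb a) (diracProb (-a)) = diracProb 0 := by
  apply Subtype.ext
  change Measure.conv (Measure.dirac a) (Measure.dirac (-a)) = Measure.dirac 0
  rw [Measure.dirac_conv_dirac, add_neg_cancel]

lemma ProbabilityMeasure.eq_of_charFun {μ ν : ProbabilityMeasure E}
    (h : ∀ t, charFun (μ : Measure E) t = charFun (ν : Measure E) t) : μ = ν := by
  have hμν : (μ : Measure E) = (ν : Measure E) := Measure.ext_of_charFun (funext h)
  exact Subtype.ext hμν

/-! ### Tightness of factors -/

/-- A form of tightness for sets of probability measures. -/
def IsTightProb (S : Set (ProbabilityMeasure E)) : Prop :=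
  ∀ ε : ENNReal, 0 < ε → ∃ K : Set E, IsCompact K ∧ ∀ μ ∈ S, (μ : Measure E) Kᶜ ≤ ε

lemma isTightProb_singleton (μ : ProbabilityMeasure E) : IsTightProb {μ} := by
  intro ε hε
  have hμ : IsTightMeasureSet {(μ : Measure E)} := isTightMeasureSet_singleton
  obtain ⟨K, hK, h⟩ := isTightMeasureSet_iff_exists_isCompact_measure_compl_le.1 hμ ε hε
  refine ⟨K, hK, fun ν hν => ?_⟩
  rw [Set.mem_singleton_iff.1 hν]
  exact h _ rfl

lemma IsTightProb.isCompact_closure {S : Set (ProbabilityMeasure E)} (hS : IsTightProb S) :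
    IsCompact (closure S) := by
  apply isCompact_closure_of_isTightMeasureSet
  rw [isTightMeasureSet_iff_exists_isCompact_measure_compl_le]
  intro ε hε
  obtain ⟨K, hK, h⟩ := hS ε hε
  refine ⟨K, hK, ?_⟩
  rintro _ ⟨μ, hμ, rfl⟩
  exact h μ hμ

/-- Prokhorov's theorem along an ultrafilter. -/
lemma IsTightProb.exists_tendsto {S : Set (ProbabilityMeasure E)} (hS : IsTightProb S)
    {ι : Type*} (U : Ultrafilter ι) (X : ι → ProbabilityMeasure E) (hX : ∀ᶠ n in U, X n ∈ S) :
    ∃ μ, Tendsto X U (𝓝 μ) := by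
  obtain ⟨μ, -, hμ⟩ := hS.isCompact_closure.ultrafilter_le_nhds (U.map X) (by
    rw [le_principal_iff]
    filter_upwards [hX] with n hn using subset_closure hn)
  exact ⟨μ, hμ⟩

/-- The factors of a tight family with tight complementary factors form a tight family. -/
lemma IsTightProb.right_factor {S T : Set (ProbabilityMeasure E)} (hS : IsTightProb S)
    (hT : IsTightProb T) : IsTightProb {Y | ∃ X ∈ S, convProb X Y ∈ T} := by
  intro ε hε
  obtain ⟨K, hK, hKS⟩ := hS (ε / 2) (ENNReal.half_pos hε.ne')
  obtain ⟨L, hL, hLT⟩ := hT (ε / 2) (ENNReal.half_pos hε.ne')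
  refine ⟨(fun p : E × E => p.1 - p.2) '' (L ×ˢ K), (hL.prod hK).image (by fun_prop), ?_⟩
  rintro Y ⟨X, hX, hXY⟩
  have hN : IsCompact ((fun p : E × E => p.1 - p.2) '' (L ×ˢ K)) :=
    (hL.prod hK).image (by fun_prop)
  set N := (fun p : E × E => p.1 - p.2) '' (L ×ˢ K) with hNdef
  let P : Measure (E × E) := (X : Measure E).prod (Y : Measure E)
  have h1 : (Y : Measure E) Nᶜ = P (Prod.snd ⁻¹' Nᶜ) := by
    rw [← Measure.map_apply measurable_snd hN.measurableSet.compl]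
    simp [P]
  have h2 : (X : Measure E) Kᶜ = P (Prod.fst ⁻¹' Kᶜ) := by
    rw [← Measure.map_apply measurable_fst hK.measurableSet.compl]
    simp [P]
  have h3 : (convProb X Y : Measure E) Lᶜ = P ((fun p : E × E => p.1 + p.2) ⁻¹' Lᶜ) := by
    rw [coe_convProb, Measure.conv, Measure.map_apply (by fun_prop) hL.measurableSet.compl]
  have hsub : (Prod.snd ⁻¹' Nᶜ : Set (E × E)) ⊆
      (fun p : E × E => p.1 + p.2) ⁻¹' Lᶜ ∪ Prod.fst ⁻¹' Kᶜ := by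
    rintro ⟨x, y⟩ hy
    by_contra hcon
    simp only [Set.mem_union, Set.mem_preimage, Set.mem_compl_iff, not_or, not_not] at hcon hy
    exact hy ⟨(x + y, x), ⟨hcon.1, hcon.2⟩, by simp⟩
  calc (Y : Measure E) Nᶜ ≤ P ((fun p : E × E => p.1 + p.2) ⁻¹' Lᶜ) + P (Prod.fst ⁻¹' Kᶜ) := by
        rw [h1]; exact (measure_mono hsub).trans (measure_union_le _ _)
    _ ≤ ε / 2 + ε / 2 := by rw [← h2, ← h3]; exact add_le_add (hLT _ hXY) (hKS _ hX)
    _ = ε := ENNReal.add_halves ε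

/-- All left factors of a given probability measure are, after suitable shifts, in one tight
family. -/
lemma exists_isTightProb_shift (μ : ProbabilityMeasure E) :
    ∃ T : Set (ProbabilityMeasure E), IsTightProb T ∧
      ∀ X Y, convProb X Y = μ → ∃ a, convProb X (diracProb a) ∈ T := by
  have hpos : ∀ j : ℕ, (0 : ENNReal) < (4 : ENNReal)⁻¹ ^ j := fun j =>
    ENNReal.pow_pos (by simp) j
  choose K hK hKμ using fun j : ℕ => isTightProb_singleton μ _ (hpos j)
  -- Since `μ (K j)ᶜ ≤ 4⁻ʲ`, the weights `2ʲ` give `∫ g dμ ≤ ∑ 2⁻ʲ = 2`. Conversely, `∫ g dν ≤ 2`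
  -- forces `ν (K j)ᶜ ≤ 2 · 2⁻ʲ`, so this bound defines a tight family.
  let g : E → ENNReal := fun x => ∑' j : ℕ, 2 ^ j * (K j)ᶜ.indicator 1 x
  have hind : ∀ j : ℕ, Measurable fun x => (2 : ENNReal) ^ j * (K j)ᶜ.indicator 1 x := fun j =>
    (measurable_one.indicator (hK j).measurableSet.compl).const_mul _
  have hg : Measurable g := Measurable.tsum hind
  have hgint : ∀ ν : Measure E, ∫⁻ x, g x ∂ν = ∑' j : ℕ, 2 ^ j * ν (K j)ᶜ := by
    intro ν
    rw [lintegral_tsum fun j => (hind j).aemeasurable]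
    refine tsum_congr fun j => ?_
    rw [lintegral_const_mul _ (measurable_one.indicator (hK j).measurableSet.compl),
      lintegral_indicator_one (hK j).measurableSet.compl]
  have hμ2 : ∫⁻ x, g x ∂(μ : Measure E) ≤ 2 := by
    refine le_of_le_of_eq ?_ ENNReal.tsum_geometric_two
    rw [hgint]
    refine ENNReal.tsum_le_tsum fun j => ?_
    calc (2 : ENNReal) ^ j * (μ : Measure E) (K j)ᶜ ≤ 2 ^ j * (4 : ENNReal)⁻¹ ^ j :=
          mul_le_mul_right (hKμ j μ rfl) _
      _ = (2⁻¹ : ENNReal) ^ j := by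
          rw [← mul_pow, show (4 : ENNReal) = 2 * 2 by norm_num,
            ENNReal.mul_inv (by simp) (by simp), ← mul_assoc,
            ENNReal.mul_inv_cancel (by simp) (by simp), one_mul]
  refine ⟨{ν | ∫⁻ x, g x ∂(ν : Measure E) ≤ 2}, ?_, ?_⟩
  · intro ε hε
    obtain ⟨j, hj⟩ := ENNReal.exists_inv_two_pow_lt (ENNReal.half_pos hε.ne').ne'
    refine ⟨K j, hK j, fun ν hν => ?_⟩
    have h1 : (2 : ENNReal) ^ j * (ν : Measure E) (K j)ᶜ ≤ 2 := by
      refine le_trans ?_ hν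
      rw [hgint]
      exact ENNReal.le_tsum j
    calc (ν : Measure E) (K j)ᶜ = (2⁻¹ : ENNReal) ^ j * (2 ^ j * (ν : Measure E) (K j)ᶜ) := by
          rw [← mul_assoc, ← mul_pow, ENNReal.inv_mul_cancel (by simp) (by simp), one_pow, one_mul]
      _ ≤ ε / 2 * 2 := mul_le_mul' hj.le h1
      _ = ε := ENNReal.div_mul_cancel (by simp) (by simp)
  · rintro X Y rfl
    have hm : Measurable fun y => ∫⁻ x, g (x + y) ∂(X : Measure E) :=
      Measurable.lintegral_prod_left' (f := fun p : E × E => g (p.1 + p.2)) (by fun_prop)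
    -- The integral of `g` against `X ∗ Y` is the `Y`-average of its integrals against the shifts of
    -- `X`, so some shift does not exceed it.
    obtain ⟨a, ha⟩ := exists_le_lintegral (μ := (Y : Measure E)) hm.aemeasurable
    refine ⟨a, ?_⟩
    rw [convProb_comm, coe_convProb, Measure.lintegral_conv hg] at hμ2
    have h2 : ∫⁻ x, g x ∂(convProb X (diracProb a) : Measure E) =
        ∫⁻ x, g (x + a) ∂(X : Measure E) := by
      rw [coe_convProb, coe_diracProb, Measure.conv_dirac, lintegral_map hg (by fun_prop)]
    simp only [Set.mem_ofPred_eq]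
    rw [h2]
    refine ha.trans (le_trans (le_of_eq ?_) hμ2)
    simp_rw [add_comm]

/-! ### Characteristic functions -/

lemma ProbabilityMeasure.tendsto_charFun {ι : Type*} {l : Filter ι}
    {X : ι → ProbabilityMeasure E} {μ : ProbabilityMeasure E} (h : Tendsto X l (𝓝 μ)) (t : E) :
    Tendsto (fun n => charFun (X n : Measure E) t) l (𝓝 (charFun (μ : Measure E) t)) := by
  rw [ProbabilityMeasure.tendsto_iff_forall_integral_rclike_tendsto ℂ] at h
  simp_rw [charFun_eq_integral_innerProbChar]
  exact h (BoundedContinuousFunction.innerProbChar t)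

lemma convProb_eq_of_tendsto {ι : Type*} {l : Filter ι} [l.NeBot]
    {X Y Z : ι → ProbabilityMeasure E} {μ ν ρ : ProbabilityMeasure E}
    (hX : Tendsto X l (𝓝 μ)) (hY : Tendsto Y l (𝓝 ν)) (hZ : Tendsto Z l (𝓝 ρ))
    (h : ∀ᶠ n in l, Z n = convProb (X n) (Y n)) : ρ = convProb μ ν := by
  refine ProbabilityMeasure.eq_of_charFun fun t => ?_
  rw [charFun_convProb]
  refine tendsto_nhds_unique (ProbabilityMeasure.tendsto_charFun hZ t)
    (((ProbabilityMeasure.tendsto_charFun hX t).mul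
      (ProbabilityMeasure.tendsto_charFun hY t)).congr' ?_)
  filter_upwards [h] with n hn
  rw [hn, charFun_convProb]

/-- The mean of `1 - cos ⟨x, t⟩ ≥ 0` vanishes, so `⟨x, t⟩ ∈ 2πℤ` almost surely, and doubling `t`
preserves this. -/
lemma charFun_two_smul_eq_one {μ : ProbabilityMeasure E} {t : E}
    (h : charFun (μ : Measure E) t = 1) : charFun (μ : Measure E) ((2 : ℝ) • t) = 1 := by
  have hint : Integrable (fun x => Complex.exp (inner ℝ x t * Complex.I)) (μ : Measure E) :=
    (integrable_const (1 : ℝ)).mono (by fun_prop) (by simp)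
  have hcos : ∫ x, (1 - Real.cos (inner ℝ x t)) ∂(μ : Measure E) = 0 := by
    have hre : ∫ x, Real.cos (inner ℝ x t) ∂(μ : Measure E) = 1 := by
      have := integral_re hint
      rw [← charFun_apply, h] at this
      simpa [Complex.exp_ofReal_mul_I_re] using this
    have hi : Integrable (fun x => Real.cos (inner ℝ x t)) (μ : Measure E) :=
      (integrable_const (1 : ℝ)).mono (by fun_prop)
        (ae_of_all _ fun x => by simpa using Real.abs_cos_le_one _)
    rw [integral_sub (integrable_const _) hi, hre]
    simp
  have hae : ∀ᵐ x ∂(μ : Measure E), Real.cos (inner ℝ x t) = 1 := by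
    have hi : Integrable (fun x => 1 - Real.cos (inner ℝ x t)) (μ : Measure E) :=
      (integrable_const (1 : ℝ)).sub ((integrable_const (1 : ℝ)).mono (by fun_prop)
        (ae_of_all _ fun x => by simpa using Real.abs_cos_le_one _))
    filter_upwards [(integral_eq_zero_iff_of_nonneg
      (fun x => sub_nonneg.2 (Real.cos_le_one _)) hi).1 hcos] with x hx
    simp only [Pi.zero_apply] at hx
    linarith
  rw [charFun_apply]
  have : ∀ᵐ x ∂(μ : Measure E),
      Complex.exp (inner ℝ x ((2 : ℝ) • t) * Complex.I) = 1 := by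
    filter_upwards [hae] with x hx
    obtain ⟨n, hn⟩ := (Real.cos_eq_one_iff _).1 hx
    rw [inner_smul_right, ← hn, Complex.exp_eq_one_iff]
    exact ⟨2 * n, by push_cast; ring⟩
  rw [integral_congr_ae this]
  simp

/-- A probability measure that fixes another one under convolution is the Dirac measure at `0`. -/
lemma eq_diracProb_zero_of_convProb_eq {κ θ : ProbabilityMeasure E} (h : convProb κ θ = κ) :
    θ = diracProb 0 := by
  -- Cancellation works only where the characteristic function of `κ` is nonzero, in particular near
  -- 0; doubling then reaches every `t`.
  have hnhds : ∀ᶠ t in 𝓝 (0 : E), charFun (θ : Measure E) t = 1 := by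
    have hne : ∀ᶠ t in 𝓝 (0 : E), charFun (κ : Measure E) t ≠ 0 :=
      (continuous_charFun (μ := (κ : Measure E))).continuousAt.eventually_ne (by simp)
    filter_upwards [hne] with t ht
    have := charFun_convProb κ θ t
    rw [h] at this
    exact mul_left_cancel₀ ht (by rw [← this, mul_one])
  refine ProbabilityMeasure.eq_of_charFun fun t => ?_
  have hlim : Tendsto (fun n : ℕ => ((2 : ℝ)⁻¹ ^ n) • t) atTop (𝓝 0) := by
    simpa using (tendsto_pow_atTop_nhds_zero_of_lt_one (r := (2 : ℝ)⁻¹) (by norm_num)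
      (by norm_num)).smul_const t
  obtain ⟨n, hn⟩ := (hlim.eventually hnhds).exists
  have key : ∀ m : ℕ, charFun (θ : Measure E) ((2 : ℝ) ^ m • ((2 : ℝ)⁻¹ ^ n) • t) = 1 := by
    intro m
    induction m with
    | zero => simpa using hn
    | succ m ih =>
      rw [pow_succ', mul_smul]
      exact charFun_two_smul_eq_one ih
  have := key n
  rw [smul_smul, ← mul_pow, mul_inv_cancel₀ (by norm_num), one_pow, one_smul] at this
  rw [this, coe_diracProb, charFun_dirac]
  simp

/-! ### The equation without `φ` -/

/-- `partialConv μ k n` is the convolution of `μ k, μ (k - 1), …, μ (k - n + 1)`. -/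
noncomputable def partialConv (μ : ℤ → ProbabilityMeasure E) : ℤ → ℕ → ProbabilityMeasure E
  | _, 0 => diracProb 0
  | k, n + 1 => convProb (μ k) (partialConv μ (k - 1) n)

lemma eq_partialConv_convProb {μ ν : ℤ → ProbabilityMeasure E}
    (h : ∀ k, ν k = convProb (μ k) (ν (k - 1))) (n : ℕ) (k : ℤ) :
    ν k = convProb (partialConv μ k n) (ν (k - n)) := by
  induction n generalizing k with
  | zero => simp [partialConv, diracProb_zero_convProb]
  | succ n ih =>
    rw [partialConv, convProb_assoc, h k, ih (k - 1)]
    congr 3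
    push_cast
    ring

/-- If `ν k = μ k ∗ ν (k - 1)` has a solution, then it has one of which every other
solution is a convolution multiple. -/
theorem exists_fundamental {μ lam : ℤ → ProbabilityMeasure E}
    (hlam : ∀ k, lam k = convProb (μ k) (lam (k - 1))) :
    ∃ κ : ℤ → ProbabilityMeasure E, (∀ k, κ k = convProb (μ k) (κ (k - 1))) ∧
      ∀ ν : ℤ → ProbabilityMeasure E, (∀ k, ν k = convProb (μ k) (ν (k - 1))) →
        ∃ ρ, ∀ k, ν k = convProb (κ k) ρ := by
  obtain ⟨T, hT, hshift⟩ := exists_isTightProb_shift (lam 0)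
  choose a ha using fun n : ℕ => hshift _ _ (eq_partialConv_convProb hlam n 0).symm
  -- The shift `a n` does not depend on `k`, so `N n` still satisfies the recursion; `R` undoes the
  -- shift. The truncation by `toNat` affects only `k < -n`, which is irrelevant as `n → ∞`.
  let N : ℕ → ℤ → ProbabilityMeasure E := fun n k =>
    convProb (partialConv μ k (k + n).toNat) (diracProb (a n))
  let R : (ℤ → ProbabilityMeasure E) → ℕ → ProbabilityMeasure E := fun ν n =>
    convProb (diracProb (-a n)) (ν (-n))
  have hN0 : ∀ n, N n 0 ∈ T := fun n => by simpa [N] using ha n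
  have hfac : ∀ ν : ℤ → ProbabilityMeasure E, (∀ k, ν k = convProb (μ k) (ν (k - 1))) →
      ∀ (n : ℕ) (k : ℤ), 0 ≤ k + n → ν k = convProb (N n k) (R ν n) := by
    intro ν hν n k hk
    have h1 := eq_partialConv_convProb hν (k + n).toNat k
    rw [Int.toNat_of_nonneg hk, show k - (k + n) = -(n : ℤ) by ring] at h1
    rw [h1, convProb_assoc, ← convProb_assoc (diracProb (a n)),
      diracProb_convProb_diracProb_neg, diracProb_zero_convProb]
  have hstep : ∀ (n : ℕ) (k : ℤ), 1 ≤ k + n → N n k = convProb (μ k) (N n (k - 1)) := by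
    intro n k hk
    have : (k + n).toNat = (k - 1 + n).toNat + 1 := by omega
    simp only [N, this, partialConv, convProb_assoc]
  have hR : ∀ ν : ℤ → ProbabilityMeasure E, (∀ k, ν k = convProb (μ k) (ν (k - 1))) →
      ∃ S, IsTightProb S ∧ ∀ n, R ν n ∈ S := fun ν hν =>
    ⟨_, hT.right_factor (isTightProb_singleton (ν 0)), fun n =>
      ⟨N n 0, hN0 n, (hfac ν hν n 0 (by simp)).symm⟩⟩
  have hev : ∀ (c k : ℤ), ∀ᶠ n : ℕ in hyperfilter ℕ, c ≤ k + n := by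
    intro c k
    refine Nat.hyperfilter_le_atTop ?_
    filter_upwards [eventually_ge_atTop (c - k).toNat] with n hn
    omega
  obtain ⟨S, hS, hRS⟩ := hR lam hlam
  -- The shifts were chosen at time 0 only, but the complementary factors `R lam n` of `N n k` are
  -- tight, which gives tightness for every `k`. One ultrafilter serves all `k` and all `ν`, so no
  -- diagonal subsequence is needed.
  have hlim : ∀ k, ∃ m, Tendsto (fun n => N n k) (hyperfilter ℕ) (𝓝 m) := fun k =>
    (hS.right_factor (isTightProb_singleton (lam k))).exists_tendsto _ _ (by
      filter_upwards [hev 0 k] with n hn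
      exact ⟨R lam n, hRS n, by rw [convProb_comm, ← hfac lam hlam n k hn]; rfl⟩)
  choose κ hκ using hlim
  refine ⟨κ, fun k => ?_, fun ν hν => ?_⟩
  · refine convProb_eq_of_tendsto tendsto_const_nhds (hκ (k - 1)) (hκ k) ?_
    filter_upwards [hev 1 k] with n hn using hstep n k hn
  · obtain ⟨S', hS', hRS'⟩ := hR ν hν
    obtain ⟨ρ, hρ⟩ := hS'.exists_tendsto (hyperfilter ℕ) (R ν) (Eventually.of_forall hRS')
    refine ⟨ρ, fun k => convProb_eq_of_tendsto (hκ k) hρ tendsto_const_nhds ?_⟩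
    filter_upwards [hev 0 k] with n hn using hfac ν hν n k hn

/-- A solution of which every solution is a convolution multiple at time `0` is one at all times,
with the same factor. -/
theorem exists_convProb_factor {μ lam : ℤ → ProbabilityMeasure E}
    (hlam : ∀ k, lam k = convProb (μ k) (lam (k - 1)))
    (h0 : ∀ ν : ℤ → ProbabilityMeasure E, (∀ k, ν k = convProb (μ k) (ν (k - 1))) →
      ∃ ρ, ν 0 = convProb (lam 0) ρ)
    {ν : ℤ → ProbabilityMeasure E} (hν : ∀ k, ν k = convProb (μ k) (ν (k - 1))) :
    ∃ ρ, ∀ k, ν k = convProb (lam k) ρ := by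
  obtain ⟨κ, hκ, hfund⟩ := exists_fundamental hlam
  obtain ⟨ρ, hρ⟩ := hfund lam hlam
  obtain ⟨σ, hσ⟩ := h0 κ hκ
  obtain ⟨τ, hτ⟩ := hfund ν hν
  have hρσ : convProb ρ σ = diracProb 0 :=
    eq_diracProb_zero_of_convProb_eq (κ := κ 0) (by rw [← convProb_assoc, ← hρ, ← hσ])
  refine ⟨convProb σ τ, fun k => ?_⟩
  rw [hρ k, convProb_assoc, ← convProb_assoc ρ, hρσ, diracProb_zero_convProb, hτ k]

/-! ### Removing and restoring `φ` -/

/-- The image of a probability measure under a linear automorphism. -/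
noncomputable def mapProb (f : E ≃ₗ[ℝ] E) (μ : ProbabilityMeasure E) : ProbabilityMeasure E :=
  ⟨Measure.map f μ, Measure.isProbabilityMeasure_map
    f.toLinearMap.continuous_of_finiteDimensional.aemeasurable⟩

lemma coe_mapProb (f : E ≃ₗ[ℝ] E) (μ : ProbabilityMeasure E) :
    (mapProb f μ : Measure E) = Measure.map f (μ : Measure E) := rfl

lemma mapProb_mul (f g : E ≃ₗ[ℝ] E) (μ : ProbabilityMeasure E) :
    mapProb (f * g) μ = mapProb f (mapProb g μ) := by
  apply Subtype.ext
  change Measure.map (f * g) (μ : Measure E) = Measure.map f (Measure.map g (μ : Measure E))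
  exact (Measure.map_map f.toLinearMap.continuous_of_finiteDimensional.measurable
    g.toLinearMap.continuous_of_finiteDimensional.measurable).symm

lemma mapProb_one (μ : ProbabilityMeasure E) : mapProb 1 μ = μ := by
  apply Subtype.ext
  change Measure.map (id : E → E) (μ : Measure E) = μ
  exact Measure.map_id

lemma mapProb_convProb (f : E ≃ₗ[ℝ] E) (μ ν : ProbabilityMeasure E) :
    mapProb f (convProb μ ν) = convProb (mapProb f μ) (mapProb f ν) :=
  Subtype.ext (Measure.map_conv_addMonoidHom (f : E →+ E)
    f.toLinearMap.continuous_of_finiteDimensional.measurable)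

end Convolution

lemma isSolution_iff {d : ℕ} {mu : ℤ → ProbabilityMeasure (EuclideanSpace ℝ (Fin d))}
    {φ : EuclideanSpace ℝ (Fin d) ≃ₗ[ℝ] EuclideanSpace ℝ (Fin d)}
    {lam : ℤ → ProbabilityMeasure (EuclideanSpace ℝ (Fin d))} :
    IsSolution mu φ lam ↔ ∀ k, lam k = convProb (mu k) (mapProb φ (lam (k - 1))) :=
  forall_congr' fun _ => ⟨fun h => Subtype.ext h, congrArg Subtype.val⟩

/-- Transforming by `φ ^ (-k)` at time `k` removes `φ` from the equation. -/
lemma IsSolution.mapProb_zpow_neg {d : ℕ} {mu : ℤ → ProbabilityMeasure (EuclideanSpace ℝ (Fin d))}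
    {φ : EuclideanSpace ℝ (Fin d) ≃ₗ[ℝ] EuclideanSpace ℝ (Fin d)}
    {lam : ℤ → ProbabilityMeasure (EuclideanSpace ℝ (Fin d))} (h : IsSolution mu φ lam) (k : ℤ) :
    mapProb (φ ^ (-k)) (lam k) =
      convProb (mapProb (φ ^ (-k)) (mu k)) (mapProb (φ ^ (-(k - 1))) (lam (k - 1))) := by
  rw [isSolution_iff.1 h k, mapProb_convProb, ← mapProb_mul, ← zpow_add_one,
    show -k + 1 = -(k - 1) by ring]

lemma isSolution_mapProb_zpow {d : ℕ} {mu : ℤ → ProbabilityMeasure (EuclideanSpace ℝ (Fin d))}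
    {φ : EuclideanSpace ℝ (Fin d) ≃ₗ[ℝ] EuclideanSpace ℝ (Fin d)}
    {κ : ℤ → ProbabilityMeasure (EuclideanSpace ℝ (Fin d))}
    (h : ∀ k, κ k = convProb (mapProb (φ ^ (-k)) (mu k)) (κ (k - 1))) :
    IsSolution mu φ fun k => mapProb (φ ^ k) (κ k) := by
  refine isSolution_iff.2 fun k => ?_
  rw [h k, mapProb_convProb, ← mapProb_mul, ← mapProb_mul, ← zpow_add, ← zpow_one_add,
    add_neg_cancel, zpow_zero, mapProb_one, add_sub_cancel]

theorem mainTheorem10 (d : ℕ)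
    (mu : ℤ → ProbabilityMeasure (EuclideanSpace ℝ (Fin d)))
    (φ : EuclideanSpace ℝ (Fin d) ≃ₗ[ℝ] EuclideanSpace ℝ (Fin d))
    (lam : ℤ → ProbabilityMeasure (EuclideanSpace ℝ (Fin d)))
    (hlam : IsSolution mu φ lam) :
    IsFundamentalSolution mu φ lam ↔
      ∀ nu : ℤ → ProbabilityMeasure (EuclideanSpace ℝ (Fin d)), IsSolution mu φ nu →
        ∃ ρ : ProbabilityMeasure (EuclideanSpace ℝ (Fin d)),
          (nu 0 : Measure (EuclideanSpace ℝ (Fin d))) =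
            Measure.conv (lam 0 : Measure (EuclideanSpace ℝ (Fin d)))
              (ρ : Measure (EuclideanSpace ℝ (Fin d))) := by
  refine ⟨fun h nu hnu => ?_, fun h => ⟨hlam, fun nu hnu => ?_⟩⟩
  · obtain ⟨ρ, hρ⟩ := h.2 nu hnu
    refine ⟨ρ, ?_⟩
    have := hρ 0
    rwa [← coe_mapProb, zpow_zero, mapProb_one] at this
  · obtain ⟨ρ, hρ⟩ := exists_convProb_factor (μ := fun k => mapProb (φ ^ (-k)) (mu k))
      (lam := fun k => mapProb (φ ^ (-k)) (lam k)) hlam.mapProb_zpow_neg (fun κ hκ => by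
        obtain ⟨ρ, hρ⟩ := h _ (isSolution_mapProb_zpow hκ)
        refine ⟨ρ, ?_⟩
        simp only [neg_zero, zpow_zero, mapProb_one] at hρ ⊢
        exact Subtype.ext hρ) hnu.mapProb_zpow_neg
    refine ⟨ρ, fun k => ?_⟩
    have := congrArg (mapProb (φ ^ k)) (hρ k)
    rw [mapProb_convProb, ← mapProb_mul, ← mapProb_mul, ← zpow_add, add_neg_cancel, zpow_zero,
      mapProb_one, mapProb_one] at this
    exact congrArg Subtype.val this
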